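/- \textbf{Setting.} Let $A$ be a totally ordered integral domain. An $\ell$-ring is a ring with a lattice order such that $a\le b$ implies $a+c\le b+c$, and $0\le a,b$ implies $0\le ab$; it is an $f$-ring if moreover $a\wedge b=0$ and $c\ge 0$ imply $ac\wedge b=0$ (equivalently, it is a subdirect product of totally ordered rings). A torsion-free $f$-algebra over $A$ is a commutative unital $A$-algebra $S$ that is an $f$-ring, is torsion-free as an $A$-module, and satisfies $as\ge 0$ whenever $0\le a\in A$ and $0\le s\in S$. For $a \in A$ write $a$ also for $a\cdot 1\in S$, and put $|s|=s\vee(-s)$. Let $\mathrm{Id}(S)$ be the Boolean algebra of idempotents of $S$. $S$ is a Specker $A$-algebra if it is generated as an $A$-algebra by a Boolean subalgebra of $\mathrm{Id}(S)$ each of whose nonzero elements $e$ is faithful ($ae=0$ with $a\in A$ implies $a=0$). A proximity on a torsion-free $f$-algebra $S$ is a binary relation $\prec$ such that: $0\prec 0$ and $1\prec 1$; $s\prec t$ implies $s\le t$; $s\le t\prec r\le u$ implies $s\prec u$; $s\prec t,r$ implies $s\prec t\wedge r$; $s\prec t$ implies $-t\prec -s$; $s\prec t$ and $r\prec u$ imply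 $s+r\prec t+u$; for $0<a\in A$, $s\prec t$ if and only if $as\prec at$; if $s,t,r,u\ge 0$, $s\prec t$ and $r\prec u$, then $sr\prec tu$; $s\prec t$ implies $s\prec r\prec t$ for some $r\in S$; and each $s>0$ admits $t>0$ with $t\prec s$. A proximity Specker $A$-algebra $(S,\prec)$ is a torsion-free $f$-algebra $S$ over $A$ that is a Specker $A$-algebra, with a proximity $\prec$. In particular $A$ itself is one, its only proximity being $\le$. For $(S,\prec)$ and $(T,\prec)$ proximity Specker $A$-algebras, a map $\alpha:S\to T$ is a proximity morphism if for all $s,t\in S$ and $a\in A$: $\alpha(0)=0$; $\alpha(s\wedge t)=\alpha(s)\wedge\alpha(t)$; $s\prec t$ implies $-\alpha(-s)\prec\alpha(t)$; $\alpha(s)$ is the least upper bound of $\{\alpha(t):t\prec s\}$; $\alpha(s+a)=\alpha(s)+a$; $\alpha(as)=a\alpha(s)$ if $a>0$; and $\alpha(s\vee a)=\alpha(s)\vee a$. For $E\subseteq S$ let $\mathord{\twoheaddownarrow}E=\{s\in S: |s|\prec t\text{ for some }t\in E\}$. The kernel of a proximity morphism $\alpha$ is $\ker\alpha=\mathord{\twoheaddownarrow}\alpha^{-1}(0)$.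 An ideal $I$ of $S$ is an $\ell$-ideal if $|s|\le|t|$ and $t\in I$ imply $s\in I$. An $\ell$-ideal $I$ is round if $I=S$, or $\mathord{\twoheaddownarrow}I=I$ and $I\cap A=0$. An end of $(S,\prec)$ is a maximal element of the set of proper round ideals. For $B=\mathrm{Id}(S)$ with the restriction of $\prec$, an ideal $E$ of the Boolean algebra $B$ is round if $E=\{b\in B: b\prec e\text{ for some }e\in E\}$, and an end of $(B,\prec)$ is a maximal element of the set of proper round ideals of $B$. \textbf{Theorem.} Let $(S,\prec)$ be a nontrivial proximity Specker $A$-algebra, $B=\mathrm{Id}(S)$, and let $I$ be an $\ell$-ideal of $S$. The following are equivalent: \begin{enumerate} \item $I$ is an end of $(S,\prec)$. \item $I$ is the kernel of a proximity morphism $\alpha:S\to A$. \item $I=\mathord{\twoheaddownarrow}P$ for some minimal prime ideal $P$ of $S$. \item $I\cap B$ is an end of $(B,\prec)$ and $I$ is the ideal of $S$ generated by $I\cap B$. \item $I$ is the ideal of $S$ generated by some end of $(B,\prec)$. \end{enumerate} -/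

import Mathlib

namespace ProximitySpecker

universe u v w

/-! ### Torsion-free `f`-algebras and Specker algebras -/

/-- An `ℓ`-ring that is an `f`-ring: the order is translation invariant, products of nonnegative
elements are nonnegative, and `a ⊓ b = 0`, `0 ≤ c` imply `a * c ⊓ b = 0`
(equivalently, the `ℓ`-ring is a subdirect product of totally ordered rings). -/
structure IsFRing (S : Type v) [CommRing S] [Lattice S] : Prop where
  add_le_add : ∀ a b : S, a ≤ b → ∀ c : S, a + c ≤ b + c
  mul_nonneg : ∀ a b : S, 0 ≤ a → 0 ≤ b → 0 ≤ a * b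
  mul_inf_eq_zero : ∀ a b c : S, a ⊓ b = 0 → 0 ≤ c → a * c ⊓ b = 0

/-- `S` is a torsion-free `f`-algebra over the totally ordered domain `A`. -/
structure IsTorsionFreeFAlgebra (A : Type u) (S : Type v) [CommRing A] [LinearOrder A]
    [CommRing S] [Lattice S] [Algebra A S] : Prop where
  fRing : IsFRing S
  smul_nonneg : ∀ (a : A) (s : S), 0 ≤ a → 0 ≤ s → 0 ≤ a • s
  torsionFree : Module.IsTorsionFree A S

/-- The Boolean algebra `Id(S)` of idempotents of a commutative ring, with
`e ≤ f ↔ e * f = e`, `e ⊓ f = e * f`, `e ⊔ f = e + f - e * f` and `eᶜ = 1 - e`. -/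
def Idem (S : Type v) [CommRing S] : Type v := {e : S // IsIdempotentElem e}

instance (S : Type v) [CommRing S] : BooleanAlgebra (Idem S) :=
  inferInstanceAs (BooleanAlgebra {e : S // IsIdempotentElem e})

/-- `S` is a Specker `A`-algebra: it is generated as an `A`-algebra by a Boolean subalgebra of
`Id(S)` whose nonzero elements are faithful. -/
def IsSpecker (A : Type u) (S : Type v) [CommRing A] [CommRing S] [Algebra A S] : Prop :=
  ∃ B : BooleanSubalgebra (Idem S),
    (∀ e ∈ B, e.1 ≠ 0 → ∀ a : A, a • e.1 = 0 → a = 0) ∧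
      Algebra.adjoin A {s : S | ∃ e ∈ B, e.1 = s} = ⊤

/-! ### Proximities -/

/-- The binary relation `prec` is a proximity on `S`. -/
structure IsProximity (A : Type u) {S : Type v} [CommRing A] [LinearOrder A]
    [CommRing S] [Lattice S] [Algebra A S] (prec : S → S → Prop) : Prop where
  zero_zero : prec 0 0
  one_one : prec 1 1
  le_of_prec : ∀ s t, prec s t → s ≤ t
  mono : ∀ s t r u, s ≤ t → prec t r → r ≤ u → prec s u
  inf : ∀ s t r, prec s t → prec s r → prec s (t ⊓ r)
  neg : ∀ s t, prec s t → prec (-t) (-s)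
  add : ∀ s t r u, prec s t → prec r u → prec (s + r) (t + u)
  smul : ∀ s t (a : A), 0 < a → prec s t → prec (a • s) (a • t)
  of_smul : ∀ s t (a : A), 0 < a → prec (a • s) (a • t) → prec s t
  mul : ∀ s t r u, 0 ≤ s → 0 ≤ t → 0 ≤ r → 0 ≤ u → prec s t → prec r u →
    prec (s * r) (t * u)
  interpolate : ∀ s t, prec s t → ∃ r, prec s r ∧ prec r t
  exists_pos : ∀ s, 0 < s → ∃ t, 0 < t ∧ prec t s

/-- `(S, prec)` is a proximity Specker `A`-algebra. -/
structure IsProximitySpecker (A : Type u) (S : Type v) [CommRing A] [LinearOrder A]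
    [CommRing S] [Lattice S] [Algebra A S] (prec : S → S → Prop) : Prop where
  fAlgebra : IsTorsionFreeFAlgebra A S
  specker : IsSpecker A S
  proximity : IsProximity A prec

/-! ### Proximity morphisms -/

/-- Proximity morphisms `(S, precS) → (T, precT)`; an element `a : A` is identified with its
image `a · 1`. -/
structure IsProximityMorphism (A : Type u) {S : Type v} {T : Type w}
    [CommRing A] [LinearOrder A] [CommRing S] [Lattice S] [Algebra A S]
    [CommRing T] [Lattice T] [Algebra A T]
    (precS : S → S → Prop) (precT : T → T → Prop) (α : S → T) : Prop where
  map_zero : α 0 = 0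
  map_inf : ∀ s t, α (s ⊓ t) = α s ⊓ α t
  prec_of_prec : ∀ s t, precS s t → precT (-α (-s)) (α t)
  isLUB : ∀ s, IsLUB {x | ∃ t, precS t s ∧ α t = x} (α s)
  map_add : ∀ s (a : A), α (s + algebraMap A S a) = α s + algebraMap A T a
  map_smul : ∀ s (a : A), 0 < a → α (a • s) = a • α s
  map_sup : ∀ s (a : A), α (s ⊔ algebraMap A S a) = α s ⊔ algebraMap A T a

/-! ### Round ideals and ends of `S` -/

/-- The set `↡E` of all `s` with `|s| ≺ t` for some `t ∈ E`. -/
def ddown {S : Type v} [CommRing S] [Lattice S] (prec : S → S → Prop) (E : Set S) : Set S :=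
  {s | ∃ t ∈ E, prec |s| t}

/-- `ℓ`-ideals. -/
def IsLIdeal {S : Type v} [CommRing S] [Lattice S] (I : Ideal S) : Prop :=
  ∀ s t : S, |s| ≤ |t| → t ∈ I → s ∈ I

/-- Round ideals: `ℓ`-ideals with `I = S`, or with `↡I = I` and `I ∩ A = 0`. -/
def IsRoundIdeal (A : Type u) {S : Type v} [CommRing A] [CommRing S] [Lattice S] [Algebra A S]
    (prec : S → S → Prop) (I : Ideal S) : Prop :=
  IsLIdeal I ∧
    (I = ⊤ ∨ (ddown prec (I : Set S) = I ∧ ∀ a : A, algebraMap A S a ∈ I → algebraMap A S a = 0))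

/-- Ends of `(S, prec)`: maximal elements among the proper round ideals. -/
def IsEnd (A : Type u) {S : Type v} [CommRing A] [CommRing S] [Lattice S] [Algebra A S]
    (prec : S → S → Prop) (I : Ideal S) : Prop :=
  Maximal (fun J : Ideal S => IsRoundIdeal A prec J ∧ J ≠ ⊤) I

/-- The kernel `↡α⁻¹(0)` of a proximity morphism. -/
def ker {S : Type v} {T : Type w} [CommRing S] [Lattice S] [Zero T]
    (prec : S → S → Prop) (α : S → T) : Set S :=
  ddown prec {s | α s = 0}

/-! ### Ends of the Boolean algebra of idempotents -/

/-- Round ideals of a Boolean algebra with a relation `prec`. -/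
def IsRoundBool {B : Type v} [BooleanAlgebra B] (prec : B → B → Prop) (E : Order.Ideal B) :
    Prop :=
  {a : B | ∃ e ∈ E, prec a e} = E

/-- Ends of a Boolean algebra with a relation `prec`: maximal elements among the proper round
ideals. -/
def IsEndBool {B : Type v} [BooleanAlgebra B] (prec : B → B → Prop) (E : Order.Ideal B) : Prop :=
  Maximal (fun J : Order.Ideal B => IsRoundBool prec J ∧ J.IsProper) E

/-- The restriction of `prec` to `Id(S)`. -/
def restrict {S : Type v} [CommRing S] (prec : S → S → Prop) (e f : Idem S) : Prop :=
  prec e.1 f.1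

theorem idem_le_iff {S : Type v} [CommRing S] (e f : Idem S) : e ≤ f ↔ e.1 * f.1 = e.1 :=
  Iff.rfl

theorem idem_sup_val {S : Type v} [CommRing S] (e f : Idem S) :
    (e ⊔ f).1 = e.1 + f.1 - e.1 * f.1 :=
  rfl

/-- The ideal `I ∩ Id(S)` of the Boolean algebra `Id(S)`. -/
def idemPart {S : Type v} [CommRing S] (I : Ideal S) : Order.Ideal (Idem S) where
  carrier := {e | e.1 ∈ I}
  lower' e f hfe he := by
    have h : f.1 * e.1 = f.1 := hfe
    change f.1 ∈ I
    rw [← h]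
    exact I.mul_mem_left _ he
  nonempty' := ⟨⟨0, .zero⟩, I.zero_mem⟩
  directed' e he f hf :=
    ⟨e ⊔ f, I.sub_mem (I.add_mem he hf) (I.mul_mem_left _ hf), le_sup_left, le_sup_right⟩

/-- The ideal of `S` generated by a set of idempotents. -/
def spanIdem {S : Type v} [CommRing S] (E : Set (Idem S)) : Ideal S :=
  Ideal.span {s : S | ∃ e ∈ E, e.1 = s}

/-! ### `A` as a proximity Specker algebra over itself -/

/-- With `≤` as the relation, `A` is a proximity Specker `A`-algebra. -/
theorem isProximitySpecker_self (A : Type u) [CommRing A] [LinearOrder A]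
    [IsStrictOrderedRing A] : IsProximitySpecker A A (· ≤ ·) where
  fAlgebra :=
    { fRing :=
        { add_le_add := fun a b h c => by linarith
          mul_nonneg := fun a b ha hb => _root_.mul_nonneg ha hb
          mul_inf_eq_zero := fun a b c h hc => by
            have ha : 0 ≤ a := h ▸ inf_le_left
            have hb : 0 ≤ b := h ▸ inf_le_right
            rcases le_total a b with hab | hab
            · rw [inf_eq_left.2 hab] at h
              simp [h, hb]
            · rw [inf_eq_right.2 hab] at h
              rw [h]
              exact inf_eq_right.2 (_root_.mul_nonneg ha hc) }
      smul_nonneg := fun a s ha hs => _root_.mul_nonneg ha hs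
      torsionFree := inferInstance }
  specker := by
    refine ⟨⊤, fun e _ he a hae => ?_, ?_⟩
    · exact (mul_eq_zero.1 hae).resolve_right he
    · exact eq_top_iff.2 fun a _ => Subalgebra.algebraMap_mem _ a
  proximity :=
    { zero_zero := le_rfl
      one_one := le_rfl
      le_of_prec := fun _ _ h => h
      mono := fun _ _ _ _ h₁ h₂ h₃ => h₁.trans (h₂.trans h₃)
      inf := fun _ _ _ h₁ h₂ => le_inf h₁ h₂
      neg := fun _ _ h => neg_le_neg h
      add := fun _ _ _ _ h₁ h₂ => add_le_add h₁ h₂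
      smul := fun _ _ _ ha h => mul_le_mul_of_nonneg_left h ha.le
      of_smul := fun _ _ _ ha h => le_of_mul_le_mul_left h ha
      mul := fun _ _ _ _ _ ht hr _ h₁ h₂ => mul_le_mul h₁ h₂ hr ht
      interpolate := fun s _ h => ⟨s, le_rfl, h⟩
      exists_pos := fun s hs => ⟨s, hs, le_rfl⟩ }

/-- The relation `≤` is the only proximity on `A`. -/
theorem proximity_self_unique (A : Type u) [CommRing A] [LinearOrder A]
    [IsStrictOrderedRing A] (prec : A → A → Prop) (h : IsProximity A prec) :
    prec = (· ≤ ·) := by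
  have hpos : ∀ a : A, 0 < a → prec a a := fun a ha => by
    simpa using h.smul 1 1 a ha h.one_one
  have hrefl : ∀ a : A, prec a a := fun a => by
    rcases lt_trichotomy a 0 with ha | ha | ha
    · simpa using h.neg _ _ (hpos (-a) (by linarith))
    · subst ha
      exact h.zero_zero
    · exact hpos a ha
  funext s t
  exact propext ⟨h.le_of_prec s t, fun hst => h.mono s s s t le_rfl (hrefl s) hst⟩

end ProximitySpecker

open ProximitySpecker

namespace ProximitySpecker

/-! ### Orthogonal decompositions and the points of a Specker algebra -/

section Points

variable {A : Type*} {S : Type*} [CommRing A] [CommRing S] [Algebra A S]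

/-! An element of a Specker algebra is a finite combination of orthogonal idempotents, so it behaves
like a finitely valued function on the set of points, the `A`-algebra maps `φ : S →ₐ[A] A`. The
kernels of points are exactly the minimal primes (`IsSpecker.exists_hom_ker_eq`,
`IsSpecker.ker_mem_minimalPrimes`), and the order is pointwise (`le_iff_hom`).

Since values are finite in number, each level set `{t ≥ c}` is an idempotent with a gap `(b, c)`
below it. Truncating at the gap turns a proximity relation in `S` into one in `Id(S)`
(`IsProximity.of_clamp`). So `↡Z` is generated by idempotents for every `Z` that matters here
(`ddown_eq_spanIdem`), and everything reduces to Boolean ends.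

The Boolean ends are the ideals `{e | e ≺ f, φ f = 0 for some f}` with `φ` a point, and they satisfy
the dichotomy: `e ≺ f` implies `e ∈ E` or `fᶜ ∈ E`. All conditions are compared with being generated
by an end `E`. Maximality passes between `S` and `Id(S)` by `exists_le_spanIdem`; minimal primes
enter through points. The morphism attached to `E` sends `s` to its minimum on the closed set of
points killing `E`. Conversely a morphism `α` yields the end `{e | α eᶜ = 1}`. -/

theorem completeOrthogonalIdempotents_prod {ι κ : Type*} [Fintype ι] [Fintype κ] {e : ι → S}
    {f : κ → S} (he : CompleteOrthogonalIdempotents e) (hf : CompleteOrthogonalIdempotents f) :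
    CompleteOrthogonalIdempotents (fun p : ι × κ => e p.1 * f p.2) where
  idem p := (he.idem p.1).mul (hf.idem p.2)
  ortho := by
    rintro ⟨i, j⟩ ⟨k, l⟩ h
    by_cases hik : i = k
    · have hjl : j ≠ l := fun h' => h (by rw [hik, h'])
      have := hf.ortho hjl
      calc e i * f j * (e k * f l) = e i * e k * (f j * f l) := by ring
        _ = 0 := by rw [this, mul_zero]
    · have := he.ortho hik
      calc e i * f j * (e k * f l) = e i * e k * (f j * f l) := by ring
        _ = 0 := by rw [this, zero_mul]
  complete := by
    rw [← Finset.univ_product_univ, Finset.sum_product, ← Finset.sum_mul_sum, he.complete, hf.complete, mul_one]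

theorem mul_eq_smul_of_sum {ι : Type*} [Fintype ι] {e : ι → S}
    (he : CompleteOrthogonalIdempotents e) {a : ι → A} {s : S} (hs : s = ∑ i, a i • e i) (i : ι) :
    s * e i = a i • e i := by
  classical
  rw [hs, Finset.sum_mul, Finset.sum_eq_single i]
  · rw [smul_mul_assoc, (he.idem i).eq]
  · intro j _ hj
    rw [smul_mul_assoc, he.ortho hj, smul_zero]
  · simp

/-- Two decompositions have a common refinement by products of their idempotents, so the elements
admitting one form a subalgebra containing the generators. -/
theorem IsSpecker.exists_sum (hB : IsSpecker A S) (s : S) :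
    ∃ (ι : Type) (_ : Fintype ι) (e : ι → S) (a : ι → A),
      CompleteOrthogonalIdempotents e ∧ s = ∑ i, a i • e i := by
  obtain ⟨B, -, hB⟩ := hB
  have hs : s ∈ Algebra.adjoin A {s : S | ∃ e ∈ B, e.1 = s} := by rw [hB]; trivial
  induction hs using Algebra.adjoin_induction with
  | mem x hx =>
    obtain ⟨e, -, rfl⟩ := hx
    exact ⟨Fin 2, inferInstance, ![e.1, 1 - e.1], ![1, 0],
      CompleteOrthogonalIdempotents.of_isIdempotentElem e.2, by simp [Fin.sum_univ_two]⟩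
  | algebraMap a =>
    refine ⟨Fin 1, inferInstance, fun _ => 1, fun _ => a, ?_, ?_⟩
    · exact (CompleteOrthogonalIdempotents.unique_iff).2 rfl
    · simp [Algebra.algebraMap_eq_smul_one]
  | add x y _ _ hx hy =>
    obtain ⟨ι, _, e, a, he, hx⟩ := hx
    obtain ⟨κ, _, f, b, hf, hy⟩ := hy
    have h := completeOrthogonalIdempotents_prod he hf
    refine ⟨ι × κ, inferInstance, _, fun p => a p.1 + b p.2, h, ?_⟩
    rw [← mul_one (x + y), ← h.complete, Finset.mul_sum]
    refine Finset.sum_congr rfl fun p _ => ?_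
    calc (x + y) * (e p.1 * f p.2) = x * e p.1 * f p.2 + e p.1 * (y * f p.2) := by ring
      _ = _ := by
        rw [mul_eq_smul_of_sum he hx, mul_eq_smul_of_sum hf hy, add_smul, smul_mul_assoc,
          mul_smul_comm]
  | mul x y _ _ hx hy =>
    obtain ⟨ι, _, e, a, he, hx⟩ := hx
    obtain ⟨κ, _, f, b, hf, hy⟩ := hy
    have h := completeOrthogonalIdempotents_prod he hf
    refine ⟨ι × κ, inferInstance, _, fun p => a p.1 * b p.2, h, ?_⟩
    rw [← mul_one (x * y), ← h.complete, Finset.mul_sum]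
    refine Finset.sum_congr rfl fun p _ => ?_
    calc (x * y) * (e p.1 * f p.2) = (x * e p.1) * (y * f p.2) := by ring
      _ = _ := by
        rw [mul_eq_smul_of_sum he hx, mul_eq_smul_of_sum hf hy, smul_mul_smul_comm]

/-- An element lies in an ideal as soon as the idempotents on which it is a nonzero constant do. -/
theorem IsSpecker.mem_of_forall (hB : IsSpecker A S) (s : S) (J : Ideal S)
    (h : ∀ (e : Idem S) (a : A), a ≠ 0 → s * e.1 = a • e.1 → e.1 ∈ J) : s ∈ J := by
  obtain ⟨ι, _, e, a, he, hs⟩ := hB.exists_sum s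
  rw [hs]
  refine J.sum_mem fun i _ => ?_
  by_cases ha : a i = 0
  · rw [ha, zero_smul]; exact J.zero_mem
  · rw [Algebra.smul_def]
    exact J.mul_mem_left _ (h ⟨e i, he.idem i⟩ (a i) ha (mul_eq_smul_of_sum he hs i))

theorem hom_compl (φ : S →ₐ[A] A) (e : Idem S) : φ eᶜ.1 = 1 - φ e.1 := by
  change φ (1 - e.1) = _
  rw [map_sub, map_one]

theorem hom_eq_of_mul_eq (φ : S →ₐ[A] A) {s e : S} {a : A} (h : s * e = a • e) (he : φ e = 1) :
    φ s = a := by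
  have := congrArg φ h
  rwa [map_mul, map_smul, he, mul_one, smul_eq_mul, mul_one] at this

variable [IsDomain A]

theorem hom_idem (φ : S →ₐ[A] A) (e : Idem S) : φ e.1 = 0 ∨ φ e.1 = 1 :=
  IsIdempotentElem.iff_eq_zero_or_one.1 (e.2.map φ)

theorem exists_hom_eq_one {ι : Type*} [Fintype ι] {e : ι → S}
    (he : CompleteOrthogonalIdempotents e) (φ : S →ₐ[A] A) : ∃ i, φ (e i) = 1 := by
  by_contra! h
  have h0 : ∀ i, φ (e i) = 0 := fun i => (hom_idem φ ⟨e i, he.idem i⟩).resolve_right (h i)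
  have := congrArg φ he.complete
  rw [map_sum, map_one, Finset.sum_eq_zero fun i _ => h0 i] at this
  exact zero_ne_one this

/-- Every point lies in an idempotent on which a given element is constant. -/
theorem IsSpecker.exists_component (hB : IsSpecker A S) (s : S) (φ : S →ₐ[A] A) :
    ∃ e : Idem S, φ e.1 = 1 ∧ s * e.1 = φ s • e.1 := by
  obtain ⟨ι, _, e, a, he, hs⟩ := hB.exists_sum s
  obtain ⟨i, hi⟩ := exists_hom_eq_one he φ
  have h := mul_eq_smul_of_sum he hs i
  exact ⟨⟨e i, he.idem i⟩, hi, by rw [hom_eq_of_mul_eq φ h hi, h]⟩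

/-- Every value is one of the coefficients. This supplies bounds and attained minima without any
completeness of `A`. -/
theorem IsSpecker.finite_values (hB : IsSpecker A S) (s : S) :
    (Set.range fun φ : S →ₐ[A] A => φ s).Finite := by
  obtain ⟨ι, _, e, a, he, hs⟩ := hB.exists_sum s
  refine (Set.finite_range a).subset ?_
  rintro _ ⟨φ, rfl⟩
  obtain ⟨i, hi⟩ := exists_hom_eq_one he φ
  exact ⟨i, (hom_eq_of_mul_eq φ (mul_eq_smul_of_sum he hs i) hi).symm⟩

/-- The quotient `S ⧸ P` is `A` itself. Injectivity: a nonzero scalar is a nonzerodivisor by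
torsion-freeness, hence avoids minimal primes. Surjectivity: some component `e i` is outside `P`,
and it annihilates `s - a i`. -/
theorem IsSpecker.exists_hom_ker_eq [Module.IsTorsionFree A S] (hB : IsSpecker A S) {P : Ideal S}
    (hP : P ∈ minimalPrimes S) : ∃ φ : S →ₐ[A] A, ∀ s, φ s = 0 ↔ s ∈ P := by
  have hprime : P.IsPrime := hP.1.1
  have hinj : Function.Injective (Algebra.ofId A (S ⧸ P)) := by
    rw [injective_iff_map_eq_zero]
    intro a ha
    by_contra ha0
    have hmem : algebraMap A S a ∈ P := Ideal.Quotient.eq_zero_iff_mem.1 ha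
    refine notMem_nonZeroDivisors_of_mem_mem_minimalPrimes hmem hP ?_
    rw [mem_nonZeroDivisors_iff_right]
    intro x hx
    rw [mul_comm, ← Algebra.smul_def] at hx
    exact (smul_eq_zero.1 hx).resolve_left ha0
  have hsurj : Function.Surjective (Algebra.ofId A (S ⧸ P)) := by
    intro x
    obtain ⟨s, rfl⟩ := Ideal.Quotient.mk_surjective x
    obtain ⟨ι, _, e, a, he, hs⟩ := hB.exists_sum s
    have hi : ∃ i, e i ∉ P := by
      by_contra! h
      exact hprime.ne_top ((Ideal.eq_top_iff_one P).2 (he.complete ▸ P.sum_mem fun i _ => h i))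
    obtain ⟨i, hi⟩ := hi
    refine ⟨a i, ?_⟩
    change Ideal.Quotient.mk P (algebraMap A S (a i)) = _
    rw [Ideal.Quotient.eq]
    refine (hprime.mem_or_mem (x := _) (y := e i) ?_).resolve_right hi
    rw [sub_mul, mul_eq_smul_of_sum he hs i, Algebra.smul_def, sub_self]
    exact P.zero_mem
  let ψ := AlgEquiv.ofBijective (Algebra.ofId A (S ⧸ P)) ⟨hinj, hsurj⟩
  refine ⟨ψ.symm.toAlgHom.comp (Ideal.Quotient.mkₐ A P), fun s => ?_⟩
  change ψ.symm (Ideal.Quotient.mk P s) = 0 ↔ _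
  rw [map_eq_zero_iff _ ψ.symm.injective, Ideal.Quotient.eq_zero_iff_mem]

/-- A minimal prime below `ker φ` is the kernel of a point `ψ`. As `s - ψ s` lies in it, `φ` kills
this difference, so `φ = ψ`. -/
theorem IsSpecker.ker_mem_minimalPrimes [Module.IsTorsionFree A S] (hB : IsSpecker A S)
    (φ : S →ₐ[A] A) : RingHom.ker φ ∈ minimalPrimes S := by
  have hp : (RingHom.ker φ).IsPrime := RingHom.ker_isPrime φ
  obtain ⟨Q, hQ, hle⟩ := Ideal.exists_minimalPrimes_le (I := ⊥) (J := RingHom.ker φ) bot_le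
  obtain ⟨ψ, hψ⟩ := hB.exists_hom_ker_eq hQ
  convert hQ
  refine le_antisymm (fun s hs => ?_) hle
  have h1 : s - algebraMap A S (ψ s) ∈ Q := by
    rw [← hψ, map_sub, AlgHom.commutes]
    exact sub_self _
  have h2 : φ (s - algebraMap A S (ψ s)) = 0 := hle h1
  rw [map_sub, AlgHom.commutes, (RingHom.mem_ker).1 hs, zero_sub, neg_eq_zero] at h2
  exact (hψ s).1 h2

/-- An idempotent outside an ideal is separated by a point from the idempotents in the ideal. -/
theorem IsSpecker.exists_separating [Module.IsTorsionFree A S] (hB : IsSpecker A S) (J : Ideal S)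
    (e : Idem S) (he : e.1 ∉ J) :
    ∃ φ : S →ₐ[A] A, φ e.1 = 1 ∧ ∀ f : Idem S, f.1 ∈ J → φ f.1 = 0 := by
  have hne : J ⊔ Ideal.span {1 - e.1} ≠ ⊤ := by
    intro h
    rw [Ideal.eq_top_iff_one, Submodule.mem_sup] at h
    obtain ⟨j, hj, r, hr, h⟩ := h
    obtain ⟨c, rfl⟩ := Ideal.mem_span_singleton'.1 hr
    apply he
    have : e.1 = e.1 * j := by
      have he2 : e.1 * e.1 = e.1 := e.2
      linear_combination (-e.1) * h - c * he2
    rw [this]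
    exact J.mul_mem_left _ hj
  obtain ⟨m, hm, hle⟩ := Ideal.exists_le_maximal _ hne
  have := hm.isPrime
  obtain ⟨P, hP, hPm⟩ := Ideal.exists_minimalPrimes_le (I := ⊥) (J := m) bot_le
  obtain ⟨φ, hφ⟩ := hB.exists_hom_ker_eq (A := A) hP
  -- Passing from `m` down to `P` loses no idempotent: if `f ∈ m` were not in `P`, then `1 - f ∈ P ≤
  -- m`.
  have key : ∀ f : Idem S, f.1 ∈ m → φ f.1 = 0 := by
    intro f hf
    refine (hom_idem φ f).resolve_right fun h1 => ?_
    have h2 : 1 - f.1 ∈ P := by rw [← hφ, map_sub, map_one, h1, sub_self]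
    exact hm.ne_top ((Ideal.eq_top_iff_one m).2 (by simpa using m.add_mem hf (hPm h2)))
  refine ⟨φ, ?_, fun f hf => key f (hle (Ideal.mem_sup_left hf))⟩
  have h := key eᶜ (hle (Ideal.mem_sup_right (Ideal.subset_span rfl)))
  rw [hom_compl] at h
  exact (sub_eq_zero.1 h).symm

theorem IsSpecker.exists_hom_idem [Module.IsTorsionFree A S] (hB : IsSpecker A S) (e : Idem S)
    (he : e.1 ≠ 0) : ∃ φ : S →ₐ[A] A, φ e.1 = 1 := by
  obtain ⟨φ, h, -⟩ := hB.exists_separating (A := A) ⊥ e he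
  exact ⟨φ, h⟩

theorem IsSpecker.ext [Module.IsTorsionFree A S] (hB : IsSpecker A S) {s t : S}
    (h : ∀ φ : S →ₐ[A] A, φ s = φ t) : s = t := by
  rw [← sub_eq_zero, ← Ideal.mem_bot]
  refine hB.mem_of_forall _ _ fun e a ha hse => ?_
  by_contra he
  obtain ⟨φ, hφ⟩ := hB.exists_hom_idem e he
  have := hom_eq_of_mul_eq φ hse hφ
  rw [map_sub, h, sub_self] at this
  exact ha this.symm

end Points

/-! ### The order of a Specker algebra is pointwise -/

section Order

/-- The idempotent `{t ≥ c}`, and a gap in the values of `t` below `c`. -/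
theorem exists_level {A : Type*} {S : Type*} [CommRing A] [LinearOrder A]
    [IsStrictOrderedRing A] [CommRing S] [Algebra A S] (hB : IsSpecker A S) (t : S) (c : A) (hc : 0 < c) :
    ∃ (g : Idem S) (b : A), 0 ≤ b ∧ b < c ∧
      ∀ φ : S →ₐ[A] A, (φ g.1 = 1 ∧ c ≤ φ t) ∨ (φ g.1 = 0 ∧ φ t ≤ b) := by
  classical
  obtain ⟨ι, _, e, a, he, hs⟩ := hB.exists_sum t
  -- The coefficients below `c`, together with `0`, which keeps the maximum `b` nonnegative and the
  -- set nonempty when every coefficient is at least `c`.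
  let T : Finset A := insert 0 (Finset.univ.image fun i => if a i < c then a i else 0)
  have hT : T.Nonempty := ⟨0, Finset.mem_insert_self _ _⟩
  refine ⟨⟨∑ i with c ≤ a i, e i, he.isIdempotentElem_sum⟩, T.max' hT,
    T.le_max' 0 (Finset.mem_insert_self _ _), ?_, fun φ => ?_⟩
  · rw [Finset.max'_lt_iff]
    intro y hy
    rcases Finset.mem_insert.1 hy with rfl | hy
    · exact hc
    · obtain ⟨i, -, rfl⟩ := Finset.mem_image.1 hy
      split_ifs with h
      · exact h
      · exact hc
  · obtain ⟨i, hi⟩ := exists_hom_eq_one he φ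
    rw [hom_eq_of_mul_eq φ (mul_eq_smul_of_sum he hs i) hi]
    have hz : ∀ j, j ≠ i → φ (e j) = 0 := fun j hj => by
      have := congrArg φ (he.ortho hj)
      rwa [map_mul, map_zero, hi, mul_one] at this
    rcases le_or_gt c (a i) with h | h
    · left
      refine ⟨?_, h⟩
      rw [map_sum, Finset.sum_eq_single i (fun j _ hj => hz j hj) (fun h' => ?_), hi]
      exact (h' (Finset.mem_filter.2 ⟨Finset.mem_univ i, h⟩)).elim
    · right
      constructor
      · rw [map_sum]
        refine Finset.sum_eq_zero fun j hj => hz j ?_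
        rintro rfl
        exact absurd (Finset.mem_filter.1 hj).2 (not_le.2 h)
      · refine T.le_max' _ (Finset.mem_insert_of_mem (Finset.mem_image.2 ⟨i, Finset.mem_univ _, ?_⟩))
        rw [if_pos h]

theorem IsFRing.isOrderedAddMonoid {S : Type*} [CommRing S] [Lattice S] (h : IsFRing S) :
    IsOrderedAddMonoid S where
  add_le_add_left a b hab c := h.add_le_add a b hab c

/-- The `f`-ring axiom, used once in each factor, makes `a * b` disjoint from itself. -/
theorem IsFRing.mul_eq_zero {S : Type*} [CommRing S] [Lattice S] (h : IsFRing S) {a b : S}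
    (hab : a ⊓ b = 0) : a * b = 0 := by
  have ha : 0 ≤ a := hab ▸ inf_le_left
  have hb : 0 ≤ b := hab ▸ inf_le_right
  have h1 := h.mul_inf_eq_zero a b b hab hb
  rw [inf_comm] at h1
  have h2 := h.mul_inf_eq_zero b (a * b) a h1 ha
  rwa [mul_comm b a, inf_idem] at h2

/-- Positive and negative parts multiply to zero, so `e = e * e` is the sum of their squares. -/
theorem IsFRing.idem_nonneg {S : Type*} [CommRing S] [Lattice S] (h : IsFRing S) (e : Idem S) :
    0 ≤ e.1 := by
  have := h.isOrderedAddMonoid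
  have h0 : e.1⁺ * e.1⁻ = 0 := h.mul_eq_zero (posPart_inf_negPart_eq_zero e.1)
  have h1 : e.1 = e.1⁺ * e.1⁺ + e.1⁻ * e.1⁻ := by
    have h2 : e.1 * e.1 = e.1 := e.2
    have h3 := posPart_sub_negPart e.1
    calc e.1 = e.1 * e.1 := h2.symm
      _ = (e.1⁺ - e.1⁻) * (e.1⁺ - e.1⁻) := by rw [h3]
      _ = _ := by linear_combination (-2) * h0
  rw [h1]
  exact add_nonneg (h.mul_nonneg _ _ (posPart_nonneg _) (posPart_nonneg _))
    (h.mul_nonneg _ _ (negPart_nonneg _) (negPart_nonneg _))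

variable {A : Type*} {S : Type*} [CommRing A] [LinearOrder A] [IsStrictOrderedRing A]
  [CommRing S] [Lattice S] [Algebra A S]

/-- On a component `e` through `φ`, a negative value would make `φ s • e` both nonnegative and
nonpositive, hence zero, although `φ e = 1`. -/
theorem hom_nonneg (hF : IsTorsionFreeFAlgebra A S) (hB : IsSpecker A S) (φ : S →ₐ[A] A) {s : S}
    (hs : 0 ≤ s) : 0 ≤ φ s := by
  have := hF.fRing.isOrderedAddMonoid
  obtain ⟨e, he, hse⟩ := hB.exists_component s φ
  by_contra! hlt
  have h1 : 0 ≤ s * e.1 := hF.fRing.mul_nonneg _ _ hs (hF.fRing.idem_nonneg e)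
  have h2 : 0 ≤ (-φ s) • e.1 :=
    hF.smul_nonneg _ _ (neg_nonneg.2 hlt.le) (hF.fRing.idem_nonneg e)
  rw [hse] at h1
  rw [neg_smul, neg_nonneg] at h2
  have h3 := congrArg φ (le_antisymm h2 h1)
  rw [map_smul, he, map_zero, smul_eq_mul, mul_one] at h3
  exact hlt.ne h3

theorem nonneg_of_hom (hF : IsTorsionFreeFAlgebra A S) (hB : IsSpecker A S) {s : S}
    (h : ∀ φ : S →ₐ[A] A, 0 ≤ φ s) : 0 ≤ s := by
  have := hF.fRing.isOrderedAddMonoid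
  have := hF.torsionFree
  obtain ⟨ι, _, e, a, he, hs⟩ := hB.exists_sum s
  rw [hs]
  refine Finset.sum_nonneg fun i _ => ?_
  by_cases hi : e i = 0
  · rw [hi, smul_zero]
  · obtain ⟨φ, hφ⟩ := hB.exists_hom_idem (A := A) ⟨e i, he.idem i⟩ hi
    have := h φ
    rw [hom_eq_of_mul_eq φ (mul_eq_smul_of_sum he hs i) hφ] at this
    exact hF.smul_nonneg _ _ this (hF.fRing.idem_nonneg ⟨e i, he.idem i⟩)

theorem le_iff_hom (hF : IsTorsionFreeFAlgebra A S) (hB : IsSpecker A S) {s t : S} :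
    s ≤ t ↔ ∀ φ : S →ₐ[A] A, φ s ≤ φ t := by
  have := hF.fRing.isOrderedAddMonoid
  rw [← sub_nonneg]
  refine ⟨fun h φ => ?_, fun h => nonneg_of_hom hF hB fun φ => ?_⟩
  · have := hom_nonneg hF hB φ h
    rwa [map_sub, sub_nonneg] at this
  · rw [map_sub, sub_nonneg]
    exact h φ

/-- The remainders `s - s ⊓ t` and `t - s ⊓ t` are disjoint, so their product is zero and `φ`, with
values in a domain, kills one of them. -/
theorem hom_inf (hF : IsTorsionFreeFAlgebra A S) (hB : IsSpecker A S) (φ : S →ₐ[A] A) (s t : S) :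
    φ (s ⊓ t) = φ s ⊓ φ t := by
  have := hF.fRing.isOrderedAddMonoid
  have h1 : φ (s ⊓ t) ≤ φ s := (le_iff_hom hF hB).1 inf_le_left φ
  have h2 : φ (s ⊓ t) ≤ φ t := (le_iff_hom hF hB).1 inf_le_right φ
  have h3 : (s - s ⊓ t) ⊓ (t - s ⊓ t) = 0 := by
    rw [← inf_sub, sub_self]
  have h4 := congrArg φ (hF.fRing.mul_eq_zero h3)
  rw [map_mul, map_zero, map_sub, map_sub] at h4
  rcases mul_eq_zero.1 h4 with h | h
  · rw [← sub_eq_zero.1 h] at h2 ⊢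
    exact (inf_eq_left.2 h2).symm
  · rw [← sub_eq_zero.1 h] at h1 ⊢
    exact (inf_eq_right.2 h1).symm

theorem hom_sup (hF : IsTorsionFreeFAlgebra A S) (hB : IsSpecker A S) (φ : S →ₐ[A] A) (s t : S) :
    φ (s ⊔ t) = φ s ⊔ φ t := by
  have := hF.fRing.isOrderedAddMonoid
  have h := congrArg φ (inf_add_sup s t)
  rw [map_add, map_add, hom_inf hF hB, ← inf_add_sup (φ s) (φ t)] at h
  exact add_left_cancel h

theorem hom_abs (hF : IsTorsionFreeFAlgebra A S) (hB : IsSpecker A S) (φ : S →ₐ[A] A) (s : S) :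
    φ |s| = |φ s| := by
  rw [abs, hom_sup hF hB, map_neg, abs]

theorem exists_abs_le (hF : IsTorsionFreeFAlgebra A S) (hB : IsSpecker A S) (s : S) :
    ∃ a : A, 0 < a ∧ ∀ φ : S →ₐ[A] A, |φ s| ≤ a := by
  obtain ⟨b, hb⟩ := (hB.finite_values (A := A) |s|).bddAbove
  refine ⟨max b 1, lt_max_of_lt_right one_pos, fun φ => le_max_of_le_left ?_⟩
  rw [← hom_abs hF hB]
  exact hb ⟨φ, rfl⟩

end Order

/-! ### Proximities on Specker algebras -/

section Proximity

/-- Clamping to `[b, c]` and subtracting `b` turns a function with no value strictly between `b` and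
`c` into `c - b` times an indicator. This case is `a • e`; the next is a level set. -/
theorem clamp_of_idem {A : Type*} [CommRing A] [LinearOrder A] {e : A} (he : e = 0 ∨ e = 1) {a b c : A} (hb : 0 ≤ b) (hbc : b < c)
    (hca : c ≤ a) : (a * e ⊓ c) ⊔ b - b = (c - b) * e := by
  rcases he with rfl | rfl
  · rw [mul_zero, mul_zero, inf_eq_left.2 (hb.trans hbc.le), sup_eq_right.2 hb, sub_self]
  · rw [mul_one, mul_one, inf_eq_right.2 hca, sup_eq_left.2 hbc.le]

theorem clamp_of_level {A : Type*} [CommRing A] [LinearOrder A] {g t b c : A} (hbc : b < c) (h : (g = 1 ∧ c ≤ t) ∨ (g = 0 ∧ t ≤ b)) :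
    (t ⊓ c) ⊔ b - b = (c - b) * g := by
  rcases h with ⟨rfl, h⟩ | ⟨rfl, h⟩
  · rw [mul_one, inf_eq_right.2 h, sup_eq_left.2 hbc.le]
  · rw [mul_zero, inf_eq_left.2 (h.trans hbc.le), sup_eq_right.2 h, sub_self]

variable {A : Type*} {S : Type*} [CommRing A] [LinearOrder A] [CommRing S] [Lattice S]
  [Algebra A S] {prec : S → S → Prop}

theorem IsProximity.compl (hp : IsProximity A prec) {e f : Idem S} (h : prec e.1 f.1) :
    prec fᶜ.1 eᶜ.1 := by
  have := hp.add _ _ _ _ hp.one_one (hp.neg _ _ h)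
  rwa [← sub_eq_add_neg, ← sub_eq_add_neg] at this

theorem IsProximity.sup (hS : IsProximitySpecker A S prec) {s t r : S} (hs : prec s r)
    (ht : prec t r) : prec (s ⊔ t) r := by
  have := hS.fAlgebra.fRing.isOrderedAddMonoid
  have hp := hS.proximity
  have h := hp.neg _ _ (hp.inf _ _ _ (hp.neg _ _ hs) (hp.neg _ _ ht))
  rwa [neg_neg, neg_inf, neg_neg, neg_neg] at h

/-- By De Morgan this is the product axiom for the complements. -/
theorem IsProximity.idem_sup (hS : IsProximitySpecker A S prec) {e f g h : Idem S}
    (h₁ : prec e.1 g.1) (h₂ : prec f.1 h.1) : prec (e ⊔ f).1 (g ⊔ h).1 := by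
  have hp := hS.proximity
  have hn := hS.fAlgebra.fRing.idem_nonneg
  have key : prec (gᶜ ⊓ hᶜ).1 (eᶜ ⊓ fᶜ).1 :=
    hp.mul _ _ _ _ (hn _) (hn _) (hn _) (hn _) (hp.compl h₁) (hp.compl h₂)
  have := hp.compl key
  rwa [compl_inf, compl_inf, compl_compl, compl_compl, compl_compl, compl_compl] at this

variable [IsStrictOrderedRing A]

theorem IsProximity.algebraMap_self (hp : IsProximity A prec) (a : A) :
    prec (algebraMap A S a) (algebraMap A S a) := by
  have hpos : ∀ a : A, 0 < a → prec (algebraMap A S a) (algebraMap A S a) := fun a ha => by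
    rw [Algebra.algebraMap_eq_smul_one]
    exact hp.smul 1 1 a ha hp.one_one
  rcases lt_trichotomy a 0 with ha | rfl | ha
  · have := hp.neg _ _ (hpos (-a) (neg_pos.2 ha))
    rwa [map_neg, neg_neg] at this
  · rw [map_zero]; exact hp.zero_zero
  · exact hpos a ha

theorem IsProximity.idem_le (hS : IsProximitySpecker A S prec) {e f : Idem S}
    (h : prec e.1 f.1) : e ≤ f := by
  have := hS.fAlgebra.torsionFree
  rw [idem_le_iff]
  refine hS.specker.ext (A := A) fun φ => ?_
  have hle := (le_iff_hom hS.fAlgebra hS.specker).1 (hS.proximity.le_of_prec _ _ h) φ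
  rw [map_mul]
  rcases hom_idem φ f with hf | hf
  · rcases hom_idem φ e with he | he
    · rw [he, zero_mul]
    · rw [he, hf] at hle
      exact absurd hle (not_le.2 one_pos)
  · rw [hf, mul_one]

theorem idem_val_le (hS : IsProximitySpecker A S prec) {e f : Idem S} (h : e ≤ f) :
    e.1 ≤ f.1 := by
  refine (le_iff_hom hS.fAlgebra hS.specker).2 fun φ => ?_
  rw [← (idem_le_iff e f).1 h, map_mul]
  rcases hom_idem φ e with he | he <;> rcases hom_idem φ f with hf | hf <;> simp [he, hf]

/-- The clamp is built only from meets, and joins and sums with constants, operations controlled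
both by a proximity and by a proximity morphism. -/
theorem clamp_eq_smul (hS : IsProximitySpecker A S prec) {r : S} {g : Idem S} {b c : A}
    (hg : ∀ φ : S →ₐ[A] A, (φ r ⊓ c) ⊔ b - b = (c - b) * φ g.1) :
    (r ⊓ algebraMap A S c) ⊔ algebraMap A S b + algebraMap A S (-b) = (c - b) • g.1 := by
  have := hS.fAlgebra.torsionFree
  refine hS.specker.ext (A := A) fun φ => ?_
  rw [map_add, hom_sup hS.fAlgebra hS.specker, hom_inf hS.fAlgebra hS.specker,
    map_smul, smul_eq_mul, ← hg, AlgHom.commutes, AlgHom.commutes, AlgHom.commutes, sub_eq_add_neg]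
  rfl

/-- Truncating at a gap turns a relation into one between idempotents. -/
theorem IsProximity.of_clamp (hS : IsProximitySpecker A S prec) {s t : S} (h : prec s t)
    {b c : A} (hbc : b < c) {e f : Idem S}
    (he : ∀ φ : S →ₐ[A] A, (φ s ⊓ c) ⊔ b - b = (c - b) * φ e.1)
    (hf : ∀ φ : S →ₐ[A] A, (φ t ⊓ c) ⊔ b - b = (c - b) * φ f.1) : prec e.1 f.1 := by
  have hp := hS.proximity
  refine hp.of_smul _ _ (c - b) (sub_pos.2 hbc) ?_
  rw [← clamp_eq_smul hS he, ← clamp_eq_smul hS hf]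
  refine hp.add _ _ _ _ ?_ (hp.algebraMap_self _)
  refine IsProximity.sup hS ?_ ?_
  · refine hp.mono _ _ _ _ le_rfl ?_ le_sup_left
    exact hp.inf _ _ _ (hp.mono _ _ _ _ inf_le_left h le_rfl)
      (hp.mono _ _ _ _ inf_le_right (hp.algebraMap_self c) le_rfl)
  · exact hp.mono _ _ _ _ le_rfl (hp.algebraMap_self b) le_sup_right

/-- If `c • e ≺ t` with `0 ≤ t`, then `e ≺ {t ≥ c}`. -/
theorem exists_prec_idem (hS : IsProximitySpecker A S prec) {e : Idem S} {t : S} {c : A}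
    (hc : 0 < c) (ht : 0 ≤ t) (h : prec (c • e.1) t) :
    ∃ g : Idem S, prec e.1 g.1 ∧ c • g.1 ≤ t := by
  obtain ⟨g, b, hb, hbc, hg⟩ := exists_level (A := A) hS.specker t c hc
  refine ⟨g, IsProximity.of_clamp hS h hbc (fun φ => ?_) fun φ => clamp_of_level hbc (hg φ), ?_⟩
  · rw [map_smul, smul_eq_mul]
    exact clamp_of_idem (hom_idem φ e) hb hbc le_rfl
  · refine (le_iff_hom hS.fAlgebra hS.specker).2 fun φ => ?_
    have h0 := hom_nonneg hS.fAlgebra hS.specker φ ht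
    rw [map_smul, smul_eq_mul]
    rcases hg φ with ⟨h1, h2⟩ | ⟨h1, -⟩
    · rwa [h1, mul_one]
    · rwa [h1, mul_zero]

/-- If `t ≺ f` with `f` idempotent, then the level sets of `t` below `1` are `≺ f`. -/
theorem exists_idem_prec (hS : IsProximitySpecker A S prec) {f : Idem S} {t : S} {c : A}
    (hc : 0 < c) (hc1 : c ≤ 1) (h : prec t f.1) :
    ∃ (g : Idem S) (b : A), prec g.1 f.1 ∧ 0 ≤ b ∧ b < c ∧
      ∀ φ : S →ₐ[A] A, (φ t ⊓ c) ⊔ b - b = (c - b) * φ g.1 := by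
  obtain ⟨g, b, hb, hbc, hg⟩ := exists_level (A := A) hS.specker t c hc
  refine ⟨g, b, ?_, hb, hbc, fun φ => clamp_of_level hbc (hg φ)⟩
  refine IsProximity.of_clamp hS h hbc (fun φ => clamp_of_level hbc (hg φ)) (fun φ => ?_)
  have := clamp_of_idem (hom_idem φ f) hb hbc hc1
  rwa [one_mul] at this

/-- Interpolate by some `r` in `S`, then clamp both relations at the level `{r ≥ 1}`. -/
theorem interpolate_idem (hS : IsProximitySpecker A S prec) {e f : Idem S} (h : prec e.1 f.1) :
    ∃ g : Idem S, prec e.1 g.1 ∧ prec g.1 f.1 := by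
  obtain ⟨r, h1, h2⟩ := hS.proximity.interpolate _ _ h
  obtain ⟨g, b, hgf, hb, hb1, hg⟩ := exists_idem_prec hS one_pos le_rfl h2
  refine ⟨g, IsProximity.of_clamp hS h1 hb1 (fun φ => ?_) hg, hgf⟩
  have := clamp_of_idem (hom_idem φ e) hb hb1 le_rfl
  rwa [one_mul] at this

end Proximity

/-! ### Round ideals of the Boolean algebra of idempotents -/

section Bool

/-- The Boolean ideal with a given carrier. -/
def boolIdeal {B : Type*} [BooleanAlgebra B] (C : Set B) (h0 : ⊥ ∈ C)
    (hl : ∀ e f, f ≤ e → e ∈ C → f ∈ C) (hs : ∀ e f, e ∈ C → f ∈ C → e ⊔ f ∈ C) :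
    Order.Ideal B where
  carrier := C
  lower' := hl
  nonempty' := ⟨⊥, h0⟩
  directed' e he f hf := ⟨e ⊔ f, hs e f he hf, le_sup_left, le_sup_right⟩

/-! ### Ideals of `S` generated by Boolean ideals -/

section Ring

variable {S : Type*} [CommRing S]

theorem isProper_iff_top {E : Order.Ideal (Idem S)} : E.IsProper ↔ ⊤ ∉ E :=
  ⟨fun h => h.top_notMem, Order.Ideal.isProper_of_notMem⟩

theorem mem_spanIdem {E : Order.Ideal (Idem S)} {s : S} :
    s ∈ spanIdem (E : Set (Idem S)) ↔ ∃ e ∈ E, s * e.1 = s := by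
  constructor
  · intro hs
    refine Submodule.span_induction ?_ ?_ ?_ ?_ hs
    · rintro _ ⟨e, he, rfl⟩
      exact ⟨e, he, e.2⟩
    · exact ⟨⊥, E.bot_mem, zero_mul _⟩
    · rintro x y - - ⟨e, he, hx⟩ ⟨f, hf, hy⟩
      refine ⟨e ⊔ f, Order.Ideal.sup_mem he hf, ?_⟩
      rw [idem_sup_val]
      -- The complement of `e ⊔ f` is `(1 - e) * (1 - f)`, which annihilates both `x` and `y`.
      linear_combination (1 - f.1) * hx + (1 - e.1) * hy
    · rintro a x - ⟨e, he, hx⟩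
      exact ⟨e, he, by rw [smul_mul_assoc, hx]⟩
  · rintro ⟨e, he, hs⟩
    rw [← hs]
    exact Ideal.mul_mem_left _ _ (Ideal.subset_span ⟨e, he, rfl⟩)

theorem idem_mem_spanIdem {E : Order.Ideal (Idem S)} {e : Idem S} :
    e.1 ∈ spanIdem (E : Set (Idem S)) ↔ e ∈ E := by
  rw [mem_spanIdem]
  exact ⟨fun ⟨f, hf, h⟩ => E.lower ((idem_le_iff e f).2 h) hf, fun h => ⟨e, h, e.2⟩⟩

theorem idemPart_spanIdem (E : Order.Ideal (Idem S)) :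
    idemPart (spanIdem (E : Set (Idem S))) = E := by
  ext e
  exact idem_mem_spanIdem

end Ring

theorem hom_idem_mono {A : Type*} {S : Type*} [CommRing A] [CommRing S] [Algebra A S]
    (φ : S →ₐ[A] A) {e f : Idem S}
    (h : e ≤ f) (hf : φ f.1 = 0) : φ e.1 = 0 := by
  rw [← (idem_le_iff e f).1 h, map_mul, hf, mul_zero]

variable {A : Type*} {S : Type*} [CommRing A] [LinearOrder A] [IsStrictOrderedRing A]
  [CommRing S] [Lattice S] [Algebra A S] {prec : S → S → Prop}

theorem isRoundBool_iff (hS : IsProximitySpecker A S prec) {E : Order.Ideal (Idem S)} :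
    IsRoundBool (restrict prec) E ↔ ∀ e ∈ E, ∃ f ∈ E, prec e.1 f.1 := by
  constructor
  · intro h e he
    have : e ∈ {a : Idem S | ∃ e ∈ E, restrict prec a e} := by rw [h]; exact he
    exact this
  · intro h
    ext e
    exact ⟨fun ⟨f, hf, hef⟩ => E.lower (IsProximity.idem_le hS hef) hf, h e⟩

/-- If a larger round ideal contains `e ≺ f` with `e ∉ E`, it contains both `f` and `fᶜ`, hence is
improper. -/
theorem isEndBool_of_dichotomy (hS : IsProximitySpecker A S prec) {E : Order.Ideal (Idem S)}
    (hr : IsRoundBool (restrict prec) E) (hp : ⊤ ∉ E)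
    (h : ∀ e f : Idem S, prec e.1 f.1 → e ∈ E ∨ fᶜ ∈ E) : IsEndBool (restrict prec) E := by
  refine ⟨⟨hr, isProper_iff_top.2 hp⟩, ?_⟩
  rintro E' ⟨hr', hp'⟩ hle e he
  obtain ⟨f, hf, hef⟩ := (isRoundBool_iff hS).1 hr' e he
  refine (h e f hef).resolve_right fun hc => isProper_iff_top.1 hp' ?_
  rw [← sup_compl_eq_top (x := f)]
  exact Order.Ideal.sup_mem hf (hle hc)

/-- The end of the Boolean algebra of idempotents determined by a point. -/
def endOfHom (hS : IsProximitySpecker A S prec) (φ : S →ₐ[A] A) : Order.Ideal (Idem S) :=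
  boolIdeal {e | ∃ f : Idem S, prec e.1 f.1 ∧ φ f.1 = 0}
    ⟨⊥, hS.proximity.zero_zero, map_zero φ⟩
    (fun e f hfe ⟨g, h1, h2⟩ => ⟨g, hS.proximity.mono _ _ _ _ (idem_val_le hS hfe) h1 le_rfl, h2⟩)
    (fun e f ⟨g, h1, h2⟩ ⟨h, h3, h4⟩ => ⟨g ⊔ h, IsProximity.idem_sup hS h1 h3, by
      rw [idem_sup_val, map_sub, map_add, map_mul, h2, h4]; simp⟩)

theorem mem_endOfHom (hS : IsProximitySpecker A S prec) (φ : S →ₐ[A] A) {e : Idem S} :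
    e ∈ endOfHom hS φ ↔ ∃ f : Idem S, prec e.1 f.1 ∧ φ f.1 = 0 :=
  Iff.rfl

/-- Interpolate `e ≺ g ≺ f`; the two cases are `φ g = 0` and `φ g = 1`. -/
theorem endOfHom_dichotomy (hS : IsProximitySpecker A S prec) (φ : S →ₐ[A] A) {e f : Idem S}
    (h : prec e.1 f.1) : e ∈ endOfHom hS φ ∨ fᶜ ∈ endOfHom hS φ := by
  obtain ⟨g, h1, h2⟩ := interpolate_idem hS h
  rcases hom_idem φ g with hg | hg
  · exact Or.inl ⟨g, h1, hg⟩
  · exact Or.inr ⟨gᶜ, hS.proximity.compl h2, by rw [hom_compl, hg, sub_self]⟩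

theorem isEndBool_endOfHom (hS : IsProximitySpecker A S prec) (φ : S →ₐ[A] A) :
    IsEndBool (restrict prec) (endOfHom hS φ) := by
  refine isEndBool_of_dichotomy hS ((isRoundBool_iff hS).2 ?_) ?_
    fun e f => endOfHom_dichotomy hS φ
  · rintro e ⟨f, hef, hf⟩
    obtain ⟨g, h1, h2⟩ := interpolate_idem hS hef
    exact ⟨g, ⟨f, h2, hf⟩, h1⟩
  · rintro ⟨f, hf, h0⟩
    have := hom_idem_mono φ (IsProximity.idem_le hS hf) h0
    exact one_ne_zero ((map_one φ).symm.trans this)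

/-- Any point killing `E` works: roundness puts `E` inside the end of that point, and maximality
gives equality. -/
theorem exists_hom_of_isEndBool (hS : IsProximitySpecker A S prec) {E : Order.Ideal (Idem S)}
    (hE : IsEndBool (restrict prec) E) : ∃ φ : S →ₐ[A] A, E = endOfHom hS φ := by
  have := hS.fAlgebra.torsionFree
  obtain ⟨φ, -, hφ⟩ := hS.specker.exists_separating (A := A) (spanIdem (E : Set (Idem S))) ⊤
    fun h => isProper_iff_top.1 hE.prop.2 (idem_mem_spanIdem.1 h)
  refine ⟨φ, hE.eq_of_le (isEndBool_endOfHom hS φ).prop fun e he => ?_⟩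
  obtain ⟨f, hf, hef⟩ := (isRoundBool_iff hS).1 hE.prop.1 e he
  exact ⟨f, hef, hφ f (idem_mem_spanIdem.2 hf)⟩

theorem IsEndBool.dichotomy (hS : IsProximitySpecker A S prec) {E : Order.Ideal (Idem S)}
    (hE : IsEndBool (restrict prec) E) {e f : Idem S} (h : prec e.1 f.1) : e ∈ E ∨ fᶜ ∈ E := by
  obtain ⟨φ, rfl⟩ := exists_hom_of_isEndBool hS hE
  exact endOfHom_dichotomy hS φ h

end Bool

section Main

variable {A : Type*} {S : Type*} [CommRing A] [LinearOrder A] [IsStrictOrderedRing A]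
  [CommRing S] [Lattice S] [Algebra A S] {prec : S → S → Prop}

/-! ### Round ideals of the algebra -/

/-- The set `↡Z` is generated by the idempotents that are `≺` some idempotent of `Z`. -/
theorem ddown_eq_spanIdem (hS : IsProximitySpecker A S prec) {Z : Set S}
    {E : Order.Ideal (Idem S)} (hE : ∀ e : Idem S, e ∈ E ↔ ∃ f : Idem S, prec e.1 f.1 ∧ f.1 ∈ Z)
    (h1 : ∀ (f : Idem S) (a : A), 0 < a → f.1 ∈ Z → a • f.1 ∈ Z)
    (h2 : ∀ (f : Idem S) (t : S) (c : A), 0 < c → t ∈ Z → c • f.1 ≤ t → f.1 ∈ Z) :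
    ddown prec Z = spanIdem (E : Set (Idem S)) := by
  have hF := hS.fAlgebra
  have hB := hS.specker
  have hp := hS.proximity
  have := hF.fRing.isOrderedAddMonoid
  ext s
  constructor
  · rintro ⟨t, htZ, ht⟩
    have ht0 : 0 ≤ t := (abs_nonneg s).trans (hp.le_of_prec _ _ ht)
    refine hB.mem_of_forall s _ fun e a ha hse => ?_
    have hle : |a| • e.1 ≤ |s| := by
      refine (le_iff_hom hF hB).2 fun φ => ?_
      rw [hom_abs hF hB, map_smul, smul_eq_mul]
      rcases hom_idem φ e with he | he
      · rw [he, mul_zero]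
        exact abs_nonneg _
      · rw [he, mul_one, hom_eq_of_mul_eq φ hse he]
    -- Since `|a| • e ≤ |s| ≺ t`, the level set `g` of `t` at `|a|` satisfies `e ≺ g`.
    obtain ⟨g, heg, hg⟩ := exists_prec_idem hS (abs_pos.2 ha) ht0 (hp.mono _ _ _ _ hle ht le_rfl)
    exact idem_mem_spanIdem.2 ((hE e).2 ⟨g, heg, h2 g t _ (abs_pos.2 ha) htZ hg⟩)
  · intro hs
    obtain ⟨e, he, hse⟩ := mem_spanIdem.1 hs
    obtain ⟨f, hef, hf⟩ := (hE e).1 he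
    obtain ⟨a, ha, hsa⟩ := exists_abs_le hF hB s
    refine ⟨a • f.1, h1 f a ha hf, hp.mono _ _ _ _ ?_ (hp.smul _ _ a ha hef) le_rfl⟩
    refine (le_iff_hom hF hB).2 fun φ => ?_
    rw [hom_abs hF hB, map_smul, smul_eq_mul]
    rcases hom_idem φ e with he | he
    · rw [← hse, map_mul, he, mul_zero, mul_zero, abs_zero]
    · rw [he, mul_one]
      exact hsa φ

theorem isLIdeal_spanIdem (hS : IsProximitySpecker A S prec) (E : Order.Ideal (Idem S)) :
    IsLIdeal (spanIdem (E : Set (Idem S))) := by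
  have hF := hS.fAlgebra
  have hB := hS.specker
  have := hF.torsionFree
  intro s t hst ht
  obtain ⟨e, he, hte⟩ := mem_spanIdem.1 ht
  refine mem_spanIdem.2 ⟨e, he, hB.ext (A := A) fun φ => ?_⟩
  rw [map_mul]
  rcases hom_idem φ e with h | h
  · have h1 := (le_iff_hom hF hB).1 hst φ
    rw [hom_abs hF hB, hom_abs hF hB, ← hte, map_mul, h, mul_zero, abs_zero] at h1
    rw [h, mul_zero, abs_nonpos_iff.1 h1]
  · rw [h, mul_one]

theorem isRoundIdeal_spanIdem (hS : IsProximitySpecker A S prec) {E : Order.Ideal (Idem S)}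
    (hr : IsRoundBool (restrict prec) E) (hp : E.IsProper) :
    IsRoundIdeal A prec (spanIdem (E : Set (Idem S))) ∧ spanIdem (E : Set (Idem S)) ≠ ⊤ := by
  have hF := hS.fAlgebra
  have hB := hS.specker
  have := hF.torsionFree
  have htop := isProper_iff_top.1 hp
  refine ⟨⟨isLIdeal_spanIdem hS E, Or.inr ⟨ddown_eq_spanIdem hS (fun e => ?_) ?_ ?_, ?_⟩⟩, ?_⟩
  · constructor
    · intro he
      obtain ⟨f, hf, hef⟩ := (isRoundBool_iff hS).1 hr e he
      exact ⟨f, hef, idem_mem_spanIdem.2 hf⟩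
    · rintro ⟨f, hef, hf⟩
      exact E.lower (IsProximity.idem_le hS hef) (idem_mem_spanIdem.1 hf)
  · intro f a _ hf
    rw [Algebra.smul_def]
    exact Ideal.mul_mem_left _ _ hf
  · intro f t c hc ht hle
    obtain ⟨u, hu, htu⟩ := mem_spanIdem.1 ht
    refine mem_spanIdem.2 ⟨u, hu, hB.ext (A := A) fun φ => ?_⟩
    have h1 := (le_iff_hom hF hB).1 hle φ
    rw [map_smul, smul_eq_mul, ← htu, map_mul] at h1
    rw [map_mul]
    rcases hom_idem φ u with h | h
    · rcases hom_idem φ f with h' | h'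
      · rw [h', zero_mul]
      · rw [h, h', mul_zero, mul_one] at h1
        exact absurd h1 (not_le.2 hc)
    · rw [h, mul_one]
  · intro b hb
    obtain ⟨e, he, hbe⟩ := mem_spanIdem.1 hb
    -- Properness leaves a point where `e` vanishes; there the constant `b` vanishes too.
    have hne : eᶜ.1 ≠ 0 := fun h0 => htop (by
      have h1 : eᶜ = ⊥ := Subtype.ext h0
      rwa [compl_eq_bot.1 h1] at he)
    obtain ⟨φ, hφ⟩ := hB.exists_hom_idem (A := A) eᶜ hne
    rw [hom_compl, sub_eq_self] at hφ
    have h1 := congrArg φ hbe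
    rw [map_mul, hφ, mul_zero, AlgHom.commutes] at h1
    have h2 : b = 0 := h1.symm
    rw [h2, map_zero]
  · intro h
    exact htop (idem_mem_spanIdem.1 (h ▸ Submodule.mem_top))

/-- A proper round ideal is contained in one generated by a proper round Boolean ideal. -/
theorem exists_le_spanIdem (hS : IsProximitySpecker A S prec) {J : Ideal S}
    (hJ : IsRoundIdeal A prec J) (hJt : J ≠ ⊤) :
    ∃ E : Order.Ideal (Idem S), IsRoundBool (restrict prec) E ∧ E.IsProper ∧
      J ≤ spanIdem (E : Set (Idem S)) := by
  have hF := hS.fAlgebra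
  have hB := hS.specker
  have hp := hS.proximity
  have := hF.torsionFree
  have := hF.fRing.isOrderedAddMonoid
  have : Nontrivial S := by
    by_contra h
    rw [not_nontrivial_iff_subsingleton] at h
    exact hJt (Subsingleton.elim _ _)
  obtain ⟨hl, hJ⟩ := hJ
  obtain ⟨hd, hA⟩ := hJ.resolve_left hJt
  have hnn : ∀ (a : A) (e : Idem S), 0 < a → 0 ≤ a • e.1 := fun a e ha =>
    hF.smul_nonneg _ _ ha.le (hF.fRing.idem_nonneg e)
  -- Scalars need not be invertible, so `J` may contain a multiple of an idempotent but not the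
  -- idempotent itself. Hence `E` is defined through positive multiples; its properness comes from
  -- `J ∩ A = 0`.
  let E : Order.Ideal (Idem S) := boolIdeal {e | ∃ a : A, 0 < a ∧ a • e.1 ∈ J}
    ⟨1, one_pos, by rw [one_smul]; exact J.zero_mem⟩
    (fun e f hfe ⟨a, ha, h⟩ => ⟨a, ha, by
      rw [← (idem_le_iff f e).1 hfe, ← mul_smul_comm]
      exact J.mul_mem_left _ h⟩)
    (fun e f ⟨a, ha, h⟩ ⟨b, hb, h'⟩ => ⟨a * b, mul_pos ha hb, by
      have : (a * b) • (e ⊔ f).1 =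
          algebraMap A S b * (a • e.1) + algebraMap A S a * (1 - e.1) * (b • f.1) := by
        rw [idem_sup_val]
        simp only [Algebra.smul_def, map_mul]
        ring
      rw [this]
      exact J.add_mem (J.mul_mem_left _ h) (J.mul_mem_left _ h')⟩)
  refine ⟨E, (isRoundBool_iff hS).2 ?_, isProper_iff_top.2 ?_, fun s hs => ?_⟩
  · rintro e ⟨a, ha, h⟩
    rw [← SetLike.mem_coe, ← hd] at h
    obtain ⟨t, htJ, ht⟩ := h
    rw [abs_of_nonneg (hnn a e ha)] at ht
    have ht0 : 0 ≤ t := (hnn a e ha).trans (hp.le_of_prec _ _ ht)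
    obtain ⟨g, heg, hg⟩ := exists_prec_idem hS ha ht0 ht
    refine ⟨g, ⟨a, ha, hl _ _ ?_ htJ⟩, heg⟩
    rwa [abs_of_nonneg (hnn a g ha), abs_of_nonneg ht0]
  · rintro ⟨a, ha, h⟩
    have h1 : a • (1 : S) ∈ J := h
    rw [← Algebra.algebraMap_eq_smul_one] at h1
    have h2 := hA a h1
    rw [Algebra.algebraMap_eq_smul_one] at h2
    exact ((smul_eq_zero.1 h2).resolve_right one_ne_zero |> ha.ne')
  · refine hB.mem_of_forall s _ fun e a ha hse => idem_mem_spanIdem.2 ⟨|a|, abs_pos.2 ha, ?_⟩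
    have h : a • e.1 ∈ J := hse ▸ J.mul_mem_right _ hs
    rcases abs_choice a with h' | h' <;> rw [h']
    · exact h
    · rw [neg_smul]
      exact J.neg_mem h

/-- A larger proper round ideal lies in the one generated by some proper round `E'`; then `E ≤ E'`,
and maximality of `E` closes the chain. -/
theorem isEnd_spanIdem (hS : IsProximitySpecker A S prec) {E : Order.Ideal (Idem S)}
    (hE : IsEndBool (restrict prec) E) : IsEnd A prec (spanIdem (E : Set (Idem S))) := by
  refine ⟨isRoundIdeal_spanIdem hS hE.prop.1 hE.prop.2, ?_⟩
  rintro J ⟨hJ, hJt⟩ hle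
  obtain ⟨E', hr, hp, hJE⟩ := exists_le_spanIdem hS hJ hJt
  have : E = E' := hE.eq_of_le ⟨hr, hp⟩ fun e he =>
    idem_mem_spanIdem.1 (hJE (hle (idem_mem_spanIdem.2 he)))
  rwa [← this] at hJE

theorem exists_of_isEnd (hS : IsProximitySpecker A S prec) {I : Ideal S} (hI : IsEnd A prec I) :
    ∃ E : Order.Ideal (Idem S), IsEndBool (restrict prec) E ∧
      I = spanIdem (E : Set (Idem S)) := by
  obtain ⟨E, hr, hp, hle⟩ := exists_le_spanIdem hS hI.prop.1 hI.prop.2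
  have hIE := hI.eq_of_le (isRoundIdeal_spanIdem hS hr hp) hle
  refine ⟨E, ⟨⟨hr, hp⟩, ?_⟩, hIE⟩
  rintro E' ⟨hr', hp'⟩ hEE' e he
  have h := hI.eq_of_le (isRoundIdeal_spanIdem hS hr' hp')
    (hIE.le.trans (Ideal.span_mono fun _ ⟨f, hf, h⟩ => ⟨f, hEE' hf, h⟩))
  exact idem_mem_spanIdem.1 (hIE ▸ h ▸ idem_mem_spanIdem.2 he)

theorem ddown_ker_hom (hS : IsProximitySpecker A S prec) (φ : S →ₐ[A] A) :
    ddown prec {s | φ s = 0} = spanIdem (endOfHom hS φ : Set (Idem S)) := by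
  refine ddown_eq_spanIdem hS (fun e => mem_endOfHom hS φ) (fun f a _ hf => ?_)
    fun f t c hc ht hle => ?_
  · change φ _ = 0
    rw [map_smul, show φ f.1 = 0 from hf, smul_zero]
  · refine (hom_idem φ f).resolve_right fun h => ?_
    have := (le_iff_hom hS.fAlgebra hS.specker).1 hle φ
    rw [map_smul, h, show φ t = 0 from ht, smul_eq_mul, mul_one] at this
    exact absurd this (not_le.2 hc)

/-! ### Proximity morphisms into the base ring -/

/-- A Nullstellensatz: a component of `s` with nonzero coefficient outside the ideal would carry a
point killing `E` but not `s`. -/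
theorem mem_spanIdem_of_forall_hom (hS : IsProximitySpecker A S prec) {E : Order.Ideal (Idem S)}
    {s : S} (h : ∀ φ : S →ₐ[A] A, (∀ e ∈ E, φ e.1 = 0) → φ s = 0) :
    s ∈ spanIdem (E : Set (Idem S)) := by
  have := hS.fAlgebra.torsionFree
  refine hS.specker.mem_of_forall s _ fun e a ha hse => ?_
  by_contra he
  obtain ⟨φ, h1, h2⟩ := hS.specker.exists_separating (A := A) _ e he
  have h3 := h φ fun f hf => h2 f (idem_mem_spanIdem.2 hf)
  rw [hom_eq_of_mul_eq φ hse h1] at h3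
  exact ha h3

/-- If `s ≺ t`, the values of `s` on the closed set of an end are below those of `t`. -/
theorem hom_le_hom_of_prec (hS : IsProximitySpecker A S prec) {E : Order.Ideal (Idem S)}
    (hE : IsEndBool (restrict prec) E) {s t : S} (hst : prec s t) {φ ψ : S →ₐ[A] A}
    (hφ : ∀ e ∈ E, φ e.1 = 0) (hψ : ∀ e ∈ E, ψ e.1 = 0) : φ s ≤ ψ t := by
  have hF := hS.fAlgebra
  have hB := hS.specker
  have hp := hS.proximity
  obtain ⟨m, -, hm⟩ := exists_abs_le hF hB s
  obtain ⟨n, -, hn⟩ := exists_abs_le hF hB t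
  by_contra! hlt
  -- Adding the constant `m ⊔ n` makes both elements nonnegative, as the level set argument
  -- requires.
  have hs : ∀ θ : S →ₐ[A] A, 0 ≤ θ s + (m ⊔ n) := fun θ => by
    have := neg_abs_le (θ s)
    have := hm θ
    have := le_max_left m n
    linarith
  have ht : ∀ θ : S →ₐ[A] A, 0 ≤ θ t + (m ⊔ n) := fun θ => by
    have := neg_abs_le (θ t)
    have := hn θ
    have := le_max_right m n
    linarith
  have hc : 0 < φ s + (m ⊔ n) := by linarith [ht ψ]
  have hmap : ∀ (θ : S →ₐ[A] A) (x : S),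
      θ (x + algebraMap A S (m ⊔ n)) = θ x + (m ⊔ n) := fun θ x => by
    rw [map_add, AlgHom.commutes]
    rfl
  obtain ⟨e, he, hse⟩ := hB.exists_component s φ
  have hle : (φ s + (m ⊔ n)) • e.1 ≤ s + algebraMap A S (m ⊔ n) := by
    refine (le_iff_hom hF hB).2 fun θ => ?_
    rw [map_smul, smul_eq_mul, hmap]
    rcases hom_idem θ e with h | h
    · rw [h, mul_zero]
      exact hs θ
    · rw [h, mul_one, hom_eq_of_mul_eq θ hse h]
  have ht0 : 0 ≤ t + algebraMap A S (m ⊔ n) :=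
    nonneg_of_hom hF hB fun θ => by rw [hmap]; exact ht θ
  obtain ⟨g, heg, hg⟩ := exists_prec_idem hS hc ht0
    (hp.mono _ _ _ _ hle (hp.add _ _ _ _ hst (hp.algebraMap_self _)) le_rfl)
  have h1 := (le_iff_hom hF hB).1 hg ψ
  rw [map_smul, smul_eq_mul, hmap] at h1
  -- The case `e ∈ E` contradicts `φ e = 1`. If `gᶜ ∈ E`, then `ψ g = 1`, which forces `φ s ≤ ψ t`.
  rcases hE.dichotomy hS heg with h | h
  · rw [hφ e h] at he
    exact zero_ne_one he
  · have h2 := hψ _ h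
    rw [hom_compl, sub_eq_zero] at h2
    rw [← h2, mul_one] at h1
    linarith

theorem exists_min_hom (hS : IsProximitySpecker A S prec) {E : Order.Ideal (Idem S)}
    (hE : ⊤ ∉ E) (s : S) :
    ∃ φ : S →ₐ[A] A, (∀ e ∈ E, φ e.1 = 0) ∧
      ∀ ψ : S →ₐ[A] A, (∀ e ∈ E, ψ e.1 = 0) → φ s ≤ ψ s := by
  have := hS.fAlgebra.torsionFree
  obtain ⟨φ, -, hφ⟩ := hS.specker.exists_separating (A := A) (spanIdem (E : Set (Idem S))) ⊤
    fun h => hE (idem_mem_spanIdem.1 h)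
  let V : Set (S →ₐ[A] A) := {φ | ∀ e ∈ E, φ e.1 = 0}
  have hfin : ((fun φ : S →ₐ[A] A => φ s) '' V).Finite :=
    (hS.specker.finite_values s).subset (Set.image_subset_range _ _)
  obtain ⟨_, ⟨φ₀, h0, rfl⟩, hmin⟩ := Set.exists_min_image _ id hfin
    ⟨_, φ, fun e he => hφ e (idem_mem_spanIdem.2 he), rfl⟩
  exact ⟨φ₀, h0, fun ψ hψ => hmin _ ⟨ψ, hψ, rfl⟩⟩

/-- The minimum over the closed set of an end is a proximity morphism with the ideal generated by
the end as its kernel. -/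
theorem exists_isProximityMorphism (hS : IsProximitySpecker A S prec) {E : Order.Ideal (Idem S)}
    (hE : IsEndBool (restrict prec) E) :
    ∃ α : S → A, IsProximityMorphism A prec (fun a b : A => a ≤ b) α ∧
      (spanIdem (E : Set (Idem S)) : Set S) = ker prec α := by
  have hF := hS.fAlgebra
  have hB := hS.specker
  have hp := hS.proximity
  have := hF.fRing.isOrderedAddMonoid
  -- Here `p s` is a point of the closed set where `s` is minimal, so the morphism is `s ↦ p s s`.
  choose p hpE hmin using exists_min_hom hS (isProper_iff_top.1 hE.prop.2)
  have hround := (isRoundBool_iff hS).1 hE.prop.1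
  have hcomm : ∀ (φ : S →ₐ[A] A) (a : A), φ (algebraMap A S a) = a := fun φ a => φ.commutes a
  have heq : ∀ (s : S) (a : A) (φ : S →ₐ[A] A), (∀ e ∈ E, φ e.1 = 0) → φ s = a →
      (∀ ψ : S →ₐ[A] A, (∀ e ∈ E, ψ e.1 = 0) → a ≤ ψ s) → p s s = a :=
    fun s a φ hφ h h' => le_antisymm (h ▸ hmin s φ hφ) (h' _ (hpE s))
  have hle : ∀ s t, s ≤ t → p s s ≤ p t t := fun s t hst =>
    (hmin s _ (hpE t)).trans ((le_iff_hom hF hB).1 hst _)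
  have hsmul : ∀ s (a : A), 0 < a → p (a • s) (a • s) = a * p s s := by
    intro s a ha
    refine heq _ _ (p s) (hpE s) (map_smul _ _ _) fun ψ hψ => ?_
    rw [map_smul, smul_eq_mul]
    exact mul_le_mul_of_nonneg_left (hmin s ψ hψ) ha.le
  have hadd : ∀ s (a : A), p (s + algebraMap A S a) (s + algebraMap A S a) = p s s + a := by
    intro s a
    refine heq _ _ (p s) (hpE s) (by rw [map_add, hcomm]) fun ψ hψ => ?_
    rw [map_add, hcomm]
    exact add_le_add_left (hmin s ψ hψ) a
  refine ⟨fun s => p s s, ⟨map_zero _, fun s t => ?_, fun s t hst => ?_, fun s => ⟨?_, ?_⟩, hadd,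
    hsmul, fun s a => ?_⟩, (ddown_eq_spanIdem hS (fun e => ⟨fun he => ?_, ?_⟩) ?_ ?_).symm⟩
  · refine le_antisymm (le_inf (hle _ _ inf_le_left) (hle _ _ inf_le_right)) ?_
    rw [hom_inf hF hB]
    exact inf_le_inf (hmin s _ (hpE _)) (hmin t _ (hpE _))
  · rw [map_neg, neg_neg]
    exact hom_le_hom_of_prec hS hE hst (hpE _) (hpE _)
  · rintro _ ⟨t, hts, rfl⟩
    exact hle t s (hp.le_of_prec _ _ hts)
  · intro x hx
    obtain ⟨m, -, hm⟩ := exists_abs_le hF hB s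
    -- On the closed set `s` is at least its minimum, so the deficit below the minimum is supported
    -- on some `e ∈ E`.
    have hu : s ⊓ algebraMap A S (p s s) - algebraMap A S (p s s) ∈
        spanIdem (E : Set (Idem S)) := by
      refine mem_spanIdem_of_forall_hom hS fun φ hφ => ?_
      rw [map_sub, hom_inf hF hB, hcomm, inf_eq_right.2 (hmin s φ hφ), sub_self]
    obtain ⟨e, he, hue⟩ := mem_spanIdem.1 hu
    obtain ⟨f, hf, hef⟩ := hround e he
    have hms := neg_abs_le (p s s)
    have hms' := hm (p s)
    have hpos : 0 < p s s + m + 1 := by linarith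
    -- This `t` equals the minimum of `s` on `fᶜ`, and `-m - 1`, below all values of `s`, on `f`.
    -- The extra `1` keeps the coefficient of `fᶜ` strictly positive. As `f ∈ E` vanishes on the
    -- closed set, `t` has the same minimum there as `s`.
    let t : S := (p s s + m + 1) • fᶜ.1 + algebraMap A S (-m - 1)
    have ht : prec t s := by
      refine hp.mono _ _ _ _ le_rfl (hp.add _ _ _ _ (hp.smul _ _ _ hpos (hp.compl hef))
        (hp.algebraMap_self _)) ?_
      refine (le_iff_hom hF hB).2 fun φ => ?_
      rw [map_add, map_smul, hom_compl, hcomm, smul_eq_mul]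
      rcases hom_idem φ e with h | h
      · have h1 := congrArg φ hue
        rw [map_mul, h, mul_zero, map_sub, hom_inf hF hB, hcomm, eq_comm, sub_eq_zero,
          inf_eq_right] at h1
        rw [h]
        linarith
      · have := neg_abs_le (φ s)
        have := hm φ
        rw [h]
        linarith
    refine le_trans ?_ (hx ⟨t, ht, rfl⟩)
    have h1 := hpE t f hf
    have h2 : p t t = (p s s + m + 1) * (1 - p t f.1) + (-m - 1) := by
      rw [← hom_compl, ← smul_eq_mul, ← map_smul]
      exact (map_add (p t) _ _).trans (congrArg _ (hcomm _ _))
    rw [h2, h1]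
    linarith
  · refine heq _ _ (p s) (hpE s) (by rw [hom_sup hF hB, hcomm]; rfl) fun ψ hψ => ?_
    rw [hom_sup hF hB, hcomm]
    exact sup_le_sup_right (hmin s ψ hψ) a
  · obtain ⟨f, hf, hef⟩ := hround e he
    exact ⟨f, hef, hpE _ f hf⟩
  · rintro ⟨f, hef, hf⟩
    -- From `e ≺ f`, every value of `e` on the closed set is at most the minimum of `f`, which is
    -- zero.
    refine idem_mem_spanIdem.1 (mem_spanIdem_of_forall_hom hS fun φ hφ => ?_)
    refine le_antisymm ?_ (hom_nonneg hF hB φ (hF.fRing.idem_nonneg e))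
    exact (hom_le_hom_of_prec hS hE hef hφ (hpE f.1)).trans (le_of_eq hf)
  · intro f a ha hf
    change p _ _ = 0
    rw [hsmul _ _ ha, show p f.1 f.1 = 0 from hf, mul_zero]
  · intro f t c hc ht hcf
    have h1 := (hsmul f.1 c hc).symm.trans_le (hle _ _ hcf)
    rw [show p t t = 0 from ht] at h1
    exact le_antisymm (nonpos_of_mul_nonpos_right h1 hc)
      (hom_nonneg hF hB _ (hF.fRing.idem_nonneg f))

/-- A morphism takes only the values `0` and `1` on idempotents. It preserves meets but need not
preserve joins, so the end is read off from `α eᶜ = 1` and not from `α e = 0`. The compatibility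
with the proximities gives the dichotomy, the least upper bound axiom gives roundness. -/
theorem isEndBool_of_isProximityMorphism (hS : IsProximitySpecker A S prec) {α : S → A}
    (hα : IsProximityMorphism A prec (fun a b : A => a ≤ b) α) :
    ∃ E : Order.Ideal (Idem S), IsEndBool (restrict prec) E ∧
      ker prec α = spanIdem (E : Set (Idem S)) := by
  have hF := hS.fAlgebra
  have hB := hS.specker
  have hp := hS.proximity
  have := hF.torsionFree
  have hmono : ∀ s t, s ≤ t → α s ≤ α t := fun s t h => by
    have := hα.map_inf s t
    rw [inf_eq_left.2 h] at this
    exact inf_eq_left.1 this.symm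
  have hconst : ∀ a : A, α (algebraMap A S a) = a := fun a => by
    have := hα.map_add 0 a
    rwa [zero_add, hα.map_zero, zero_add] at this
  have hone : α 1 = 1 := by simpa using hconst 1
  have hcomm : ∀ (φ : S →ₐ[A] A) (a : A), φ (algebraMap A S a) = a := fun φ a => φ.commutes a
  have hnn : ∀ e : Idem S, 0 ≤ α e.1 := fun e => by
    rw [← hα.map_zero]
    exact hmono _ _ (hF.fRing.idem_nonneg e)
  have hinf : ∀ e f : Idem S, α (e ⊓ f).1 = α e.1 ⊓ α f.1 := fun e f => by
    rw [← hα.map_inf]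
    congr 1
    refine hB.ext (A := A) fun φ => ?_
    change φ (e.1 * f.1) = _
    rw [map_mul, hom_inf hF hB]
    rcases hom_idem φ e with he | he <;> rcases hom_idem φ f with hf | hf <;> simp [he, hf]
  have hle1 : ∀ e : Idem S, α e.1 ≤ 1 := fun e => by
    rw [← hone]
    refine hmono _ _ ((le_iff_hom hF hB).2 fun φ => ?_)
    rw [map_one]
    rcases hom_idem φ e with he | he <;> simp [he]
  have h01 : ∀ e : Idem S, α e.1 = 0 ∨ α e.1 = 1 := fun e => by
    rcases (hnn e).eq_or_lt with h | h
    · exact Or.inl h.symm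
    · right
      -- Applying `α` to this identity shows that `α e` equals its own square.
      have h1 : e.1 ⊓ algebraMap A S (α e.1) = α e.1 • e.1 := by
        refine hB.ext (A := A) fun φ => ?_
        rw [hom_inf hF hB, hcomm, map_smul, smul_eq_mul]
        rcases hom_idem φ e with he | he
        · rw [he, mul_zero, inf_eq_left.2 h.le]
        · rw [he, mul_one, inf_eq_right.2 (hle1 e)]
      have h2 := congrArg α h1
      rw [hα.map_inf, hconst, inf_idem, hα.map_smul _ _ h, smul_eq_mul] at h2
      exact (mul_eq_left₀ h.ne').1 h2.symm
  have hcompl : ∀ e : Idem S, α eᶜ.1 = 1 → α e.1 = 0 := fun e he => by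
    have h := hinf e eᶜ
    rw [inf_compl_self, he, inf_eq_left.2 (hle1 e)] at h
    rw [← h]
    exact hα.map_zero
  have hdich : ∀ e f : Idem S, prec e.1 f.1 → α eᶜ.1 = 1 ∨ α f.1 = 1 := fun e f h => by
    refine (h01 eᶜ).symm.imp_right fun he => le_antisymm (hle1 f) ?_
    have h1 := hα.map_add (-e.1) 1
    rw [map_one, map_one, show -e.1 + 1 = eᶜ.1 from neg_add_eq_sub _ _, he] at h1
    have h2 : -α (-e.1) ≤ α f.1 := hα.prec_of_prec _ _ h
    linarith
  let E : Order.Ideal (Idem S) := boolIdeal {e | α eᶜ.1 = 1}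
    (by change α (⊥ : Idem S)ᶜ.1 = 1; rw [compl_bot]; exact hone)
    (fun e f hfe he => le_antisymm (hle1 _)
      (le_of_eq_of_le he.symm (hmono _ _ (idem_val_le hS (compl_le_compl hfe)))))
    (fun e f he hf => by
      change α (e ⊔ f)ᶜ.1 = 1
      rw [compl_sup, hinf, show α eᶜ.1 = 1 from he, show α fᶜ.1 = 1 from hf, inf_idem])
  have hround : ∀ e ∈ E, ∃ f ∈ E, prec e.1 f.1 := by
    intro e he
    have he : α eᶜ.1 = 1 := he
    -- The least upper bound axiom gives such a `t`. Clamping it at the level `α t`, a map with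
    -- which `α` commutes, gives `g ≺ eᶜ` with `α g = 1`; then `e ≺ gᶜ`.
    obtain ⟨t, ht, ht0⟩ : ∃ t, prec t eᶜ.1 ∧ 0 < α t := by
      by_contra! h
      have : α eᶜ.1 ≤ 0 := (hα.isLUB eᶜ.1).2 (by rintro _ ⟨t, ht, rfl⟩; exact h t ht)
      rw [he] at this
      exact absurd this (not_le.2 one_pos)
    have hc1 : α t ≤ 1 := (hmono _ _ (hp.le_of_prec _ _ ht)).trans (hle1 _)
    obtain ⟨g, b, hg, hb, hbc, hgt⟩ := exists_idem_prec hS ht0 hc1 ht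
    have h1 := congrArg α (clamp_eq_smul hS hgt)
    rw [hα.map_add, hα.map_sup, hα.map_inf, hconst, inf_idem, hα.map_smul _ _ (sub_pos.2 hbc)] at h1
    have h2 : (α t - b) * α g.1 = α t - b := by
      rw [← smul_eq_mul, ← h1]
      change α t ⊔ b + -b = _
      rw [sup_eq_left.2 hbc.le, sub_eq_add_neg]
    have h3 : α g.1 = 1 := (mul_eq_left₀ (sub_pos.2 hbc).ne').1 h2
    have h4 := hp.compl hg
    rw [compl_compl] at h4
    refine ⟨gᶜ, ?_, h4⟩
    change α gᶜᶜ.1 = 1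
    rwa [compl_compl]
  have hdichE : ∀ e f : Idem S, prec e.1 f.1 → e ∈ E ∨ fᶜ ∈ E := fun e f h =>
    (hdich e f h).imp_right fun hf => by
      change α fᶜᶜ.1 = 1
      rwa [compl_compl]
  refine ⟨E, isEndBool_of_dichotomy hS ((isRoundBool_iff hS).2 hround) ?_ hdichE,
    ddown_eq_spanIdem hS (fun e => ⟨fun he => ?_, ?_⟩) ?_ ?_⟩
  · intro h
    have h : α (⊤ : Idem S)ᶜ.1 = 1 := h
    rw [compl_top] at h
    exact zero_ne_one (hα.map_zero.symm.trans h)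
  · obtain ⟨f, hf, hef⟩ := hround e he
    exact ⟨f, hef, hcompl f hf⟩
  · rintro ⟨f, hef, hf⟩
    refine (hdich e f hef).resolve_right fun h => ?_
    rw [show α f.1 = 0 from hf] at h
    exact zero_ne_one h
  · intro f a ha hf
    change α _ = 0
    rw [hα.map_smul _ _ ha, show α f.1 = 0 from hf, smul_zero]
  · intro f t c hc ht hcf
    have h1 := hmono _ _ hcf
    rw [hα.map_smul _ _ hc, show α t = 0 from ht, smul_eq_mul] at h1
    exact le_antisymm (nonpos_of_mul_nonpos_right h1 hc) (hnn f)

end Main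

end ProximitySpecker

open ProximitySpecker
theorem mainTheorem6 {A : Type*} {S : Type*} [CommRing A] [LinearOrder A] [IsStrictOrderedRing A]
    [CommRing S] [Lattice S] [Algebra A S] [Nontrivial S] (prec : S → S → Prop)
    (hS : IsProximitySpecker A S prec) (I : Ideal S) (hI : IsLIdeal I) :
    List.TFAE
      [IsEnd A prec I,
        ∃ α : S → A, IsProximityMorphism A prec (fun a b : A => a ≤ b) α ∧
          (I : Set S) = ProximitySpecker.ker prec α,
        ∃ P ∈ minimalPrimes S, (I : Set S) = ddown prec (P : Set S),
        IsEndBool (restrict prec) (idemPart I) ∧ I = spanIdem (idemPart I : Set (Idem S)),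
        ∃ E : Order.Ideal (Idem S), IsEndBool (restrict prec) E ∧
          I = spanIdem (E : Set (Idem S))] := by
  have := hS.fAlgebra.torsionFree
  tfae_have 1 → 5 := exists_of_isEnd hS
  tfae_have 5 → 1 := by
    rintro ⟨E, hE, rfl⟩
    exact isEnd_spanIdem hS hE
  tfae_have 5 → 2 := by
    rintro ⟨E, hE, rfl⟩
    exact exists_isProximityMorphism hS hE
  tfae_have 2 → 5 := by
    rintro ⟨α, hα, h⟩
    obtain ⟨E, hE, hE'⟩ := isEndBool_of_isProximityMorphism hS hα
    exact ⟨E, hE, SetLike.coe_injective (h.trans hE')⟩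
  tfae_have 5 → 3 := by
    rintro ⟨E, hE, rfl⟩
    obtain ⟨φ, rfl⟩ := exists_hom_of_isEndBool hS hE
    exact ⟨RingHom.ker φ, hS.specker.ker_mem_minimalPrimes φ, (ddown_ker_hom hS φ).symm⟩
  tfae_have 3 → 5 := by
    rintro ⟨P, hP, h⟩
    obtain ⟨φ, hφ⟩ := hS.specker.exists_hom_ker_eq (A := A) hP
    have hset : (P : Set S) = {s | φ s = 0} := Set.ext fun s => (hφ s).symm
    rw [hset, ddown_ker_hom hS φ] at h
    exact ⟨endOfHom hS φ, isEndBool_endOfHom hS φ, SetLike.coe_injective h⟩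
  tfae_have 4 → 5 := fun h => ⟨idemPart I, h⟩
  tfae_have 5 → 4 := by
    rintro ⟨E, hE, rfl⟩
    rw [idemPart_spanIdem]
    exact ⟨hE, rfl⟩
  tfae_finish
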